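/- Let $\|\cdot\|$ be an arbitrary norm on $\mathbb{R}^2$. Let $M=M_{\|\cdot\|}$ be the maximum of $\left(\frac{4ac}{4D^2-1}\right)^{1/4}$ over all real $a,c>0$ and $D\ge 1$ such that $$\sqrt{au_1^2+cu_2^2}\;\le\;\|u\|\;\le\; D\sqrt{au_1^2+cu_2^2}\qquad\text{for all } u=(u_1,u_2)\in\mathbb{R}^2;$$ this maximum exists. On $\mathbb{R}^3=\mathbb{R}^2\times\mathbb{R}$ put $\|(x,z)\|^*=\max\{\|x\|,|z|\}$. For a lattice $L\subset\mathbb{R}^3$ of covolume $1$ let $\lambda_1(L)=\min\{\|u\|^*: 0\ne u\in L\}$. For $\varepsilon>0$ let $K_\varepsilon$ be the set of lattices $L\subset\mathbb{R}^3$ of covolume $1$ with $\lambda_1(L)\ge\varepsilon$, and for $t\in\mathbb{R}$ let $g_t=\mathrm{diag}(e^t,e^t,e^{-2t})$. Then for every $r$ with $0<r\le M^{2/3}$, the set of lattices $L\subset\mathbb{R}^3$ of covolume $1$ such that $$r=\min\{\varepsilon>0 : g_tL\notin K_\varepsilon \text{ for all large enough } t\}$$ has the cardinality of the continuum. The same holds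 for $r=0$ with the minimum replaced by the infimum. -/

import Mathlib

open Cardinal Filter

noncomputable section

namespace DirichletLattice

/-- `a, c > 0` and `D ≥ 1` are admissible ellipsoid parameters for the norm `N` on `ℝ²`: the norm
`√(a u₁² + c u₂²)` is at most `N u`, and `N u` is at most `D` times it. -/
def IsEllipsoidParams (N : Seminorm ℝ (Fin 2 → ℝ)) (a c D : ℝ) : Prop :=
  0 < a ∧ 0 < c ∧ 1 ≤ D ∧ ∀ u : Fin 2 → ℝ,
    Real.sqrt (a * u 0 ^ 2 + c * u 1 ^ 2) ≤ N u ∧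
      N u ≤ D * Real.sqrt (a * u 0 ^ 2 + c * u 1 ^ 2)

/-- All values `(4ac / (4D² - 1))^(1/4)` over admissible ellipsoid parameters. -/
def ellipsoidValues (N : Seminorm ℝ (Fin 2 → ℝ)) : Set ℝ :=
  {m | ∃ a c D : ℝ, IsEllipsoidParams N a c D ∧
    m = (4 * a * c / (4 * D ^ 2 - 1)) ^ (1 / 4 : ℝ)}

/-- The constant `M` of the norm `N`: the largest of the values above. -/
def ellipsoidConstant (N : Seminorm ℝ (Fin 2 → ℝ)) : ℝ :=
  sSup (ellipsoidValues N)

/-- The norm `max(N x, |z|)` of `(x, z) ∈ ℝ² × ℝ = ℝ³`. -/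
def starNorm (N : Seminorm ℝ (Fin 2 → ℝ)) (u : Fin 3 → ℝ) : ℝ :=
  max (N ![u 0, u 1]) |u 2|

/-- The space of lattices of covolume `1` in `ℝ³`. -/
def unimodularLattices : Set (Submodule ℤ (Fin 3 → ℝ)) :=
  {L | ∃ _ : DiscreteTopology L, IsZLattice ℝ L ∧ ZLattice.covolume L = 1}

/-- The first minimum of `L` for `starNorm N`: the least norm of a nonzero vector of `L`. -/
def firstMinimum (N : Seminorm ℝ (Fin 2 → ℝ)) (L : Submodule ℤ (Fin 3 → ℝ)) : ℝ :=
  sInf (starNorm N '' {u | u ∈ L ∧ u ≠ 0})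

/-- The set of unimodular lattices whose first minimum is at least `ε`. -/
def compactPart (N : Seminorm ℝ (Fin 2 → ℝ)) (ε : ℝ) : Set (Submodule ℤ (Fin 3 → ℝ)) :=
  {L | L ∈ unimodularLattices ∧ ε ≤ firstMinimum N L}

/-- The matrix `diag(e^t, e^t, e^(-2t))`. -/
def flowMatrix (t : ℝ) : Matrix (Fin 3) (Fin 3) ℝ :=
  Matrix.diagonal ![Real.exp t, Real.exp t, Real.exp (-2 * t)]

/-- The image `g_t L` of `L` under `diag(e^t, e^t, e^(-2t))`. -/
def flow (t : ℝ) (L : Submodule ℤ (Fin 3 → ℝ)) : Submodule ℤ (Fin 3 → ℝ) :=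
  L.map ((flowMatrix t).mulVecLin.restrictScalars ℤ)

/-- The set of all `ε > 0` such that `g_t L` lies outside `compactPart N ε` for all large `t`. -/
def escapeSet (N : Seminorm ℝ (Fin 2 → ℝ)) (L : Submodule ℤ (Fin 3 → ℝ)) : Set ℝ :=
  {ε | 0 < ε ∧ ∀ᶠ t : ℝ in atTop, flow t L ∉ compactPart N ε}

/-- `r` is the threshold of `L`: for `r > 0` it is the minimum of the escape set. As the escape set
consists of positive numbers, for `r = 0` the threshold is the infimum. -/
def IsThreshold (N : Seminorm ℝ (Fin 2 → ℝ)) (L : Submodule ℤ (Fin 3 → ℝ)) (r : ℝ) : Prop :=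
  (0 < r → IsLeast (escapeSet N L) r) ∧ (r = 0 → IsGLB (escapeSet N L) 0)

end DirichletLattice

end

/-!
The maximum defining `M` exists by compactness: a positive lower bound on the value bounds `D`, and
comparison with the norm bounds `a` and `c` (`exists_isGreatest_ellipsoidValues`).

For the second part one lattice `L` with threshold `r` is enough. The lattices `g_s L`, `s ∈ ℝ`, have
the same threshold and, for the lattices used here, are pairwise distinct (`mk_threshold_eq`), and
there are at most continuum many lattices altogether. For `r = 0` take `L = ℤ³`.

For `r > 0` the lattice consists of the vectors `(q ξ - p, q)`, where `ξ ∈ ℝ²` is a limit of rational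
points `p_k / q_k` given by integer vectors `v_k = (p_k, q_k)` with
`v_{k+1} = m v_k + B v_{k-1} + v_{k-2}`, so that any three consecutive vectors have determinant one.
Put `s = r ^ 3` and `δ_k = N (q_k ξ - p_k)`. The vector `v_k` shows that the first minimum of `g_t L`
is less than `r` while `q_k < r e^{2t} ≤ q_{k+1}`, as soon as `δ_k ^ 2 q_{k+1} < s`. Conversely, at
the time with `r e^{2t} = q_{k+1}` the first minimum is close to `r` if `δ_k ^ 2 q_{k+1}` is close to
`s` and no integer vector with denominator below `q_{k+1}` has a defect much smaller than `δ_k`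
(`isThreshold_of_nearCritical`).

The latter is a property of the projection of `ℤ³` along `v_{k+1}`, a planar lattice of covolume
`1 / q_{k+1}` containing the projection `e` of `v_k`, with `N e = δ_k`. Let `E ≤ N` be the inner
ellipsoid norm. If a second basis vector has a component along `e` (for the inner product of `E`)
close to `e / 2` modulo `e`, then all vectors outside `ℤ e` have `E`-length, and so `N`-length, at
least about `δ_k`, provided that the covolume is not below that of the hexagonal lattice; and this is
`3 s ^ 2 ≤ 4 a c`, which follows from `r ≤ M ^ (2 / 3)` (`le_quadratic_of_half_shift`). For a large
`B`, the size condition on `q_{k+1}` leaves an interval of `m` of length of order `B ^ 2`, while the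
shift rotates by a step of order `1 / B` as `m` increases, so that both conditions can be met
(`exists_coefficients`, `exists_next`). All conditions are open at the new rational point, and `ξ`
is found in an intersection of nested balls (`exists_nearCritical`).
-/

namespace DirichletLattice

/-! ### Half-odd shifts in planar lattices -/

/-- Along an arithmetic progression of difference `q` beyond `Y`, the slowly varying quantity
`Q / q * θ - c` comes within its step `θ` of a half-odd number before `Y + q * (2 + 1 / θ)`. -/
theorem exists_int_window {q θ : ℝ} (hq : 0 < q) (hθ : 0 < θ) (o Y c : ℝ) :
    ∃ m n : ℤ, Y < m * q + o ∧ m * q + o ≤ Y + q * (2 + 1 / θ) ∧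
      |(m * q + o) / q * θ - c - (n + 1 / 2)| ≤ θ := by
  -- start just above `Y` at `m₀`, then take `k` more steps to pass the next half-odd number
  set m₀ : ℤ := ⌊(Y - o) / q⌋ + 1 with hm₀
  have h1 : (Y - o) / q < m₀ := by rw [hm₀]; push_cast; exact Int.lt_floor_add_one _
  have h2 : (m₀ : ℝ) ≤ (Y - o) / q + 1 := by
    rw [hm₀]; push_cast; linarith [Int.floor_le ((Y - o) / q)]
  rw [div_lt_iff₀ hq] at h1
  have h2' : (m₀ : ℝ) * q ≤ (Y - o) + q := by
    have := mul_le_mul_of_nonneg_right h2 hq.le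
    rwa [add_mul, div_mul_cancel₀ _ hq.ne', one_mul] at this
  set τ₀ : ℝ := (m₀ * q + o) / q * θ - c with hτ₀
  set n : ℤ := ⌈τ₀ - 1 / 2⌉ with hn
  have h3 : τ₀ - 1 / 2 ≤ n := Int.le_ceil _
  have h4 : (n : ℝ) < τ₀ - 1 / 2 + 1 := Int.ceil_lt_add_one _
  set k : ℤ := ⌈(n + 1 / 2 - τ₀) / θ⌉ with hk
  have h5 : (n + 1 / 2 - τ₀) / θ ≤ k := Int.le_ceil _
  have h6 : (k : ℝ) < (n + 1 / 2 - τ₀) / θ + 1 := Int.ceil_lt_add_one _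
  have h7 : 0 ≤ (n + 1 / 2 - τ₀) / θ := div_nonneg (by linarith) hθ.le
  have h8 : (n + 1 / 2 - τ₀) / θ ≤ 1 / θ := by gcongr; linarith
  have h5' : n + 1 / 2 - τ₀ ≤ k * θ := by rwa [div_le_iff₀ hθ] at h5
  have h6' : k * θ < n + 1 / 2 - τ₀ + θ := by
    have := mul_lt_mul_of_pos_right h6 hθ
    rwa [add_mul, div_mul_cancel₀ _ hθ.ne', one_mul] at this
  refine ⟨m₀ + k, n, ?_, ?_, ?_⟩
  · push_cast
    have : 0 ≤ (k : ℝ) * q := mul_nonneg (h7.trans h5) hq.le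
    linarith
  · push_cast
    have : (k : ℝ) * q ≤ (1 / θ + 1) * q := by gcongr; linarith
    linarith
  · have : (((m₀ + k : ℤ) : ℝ) * q + o) / q * θ - c - (n + 1 / 2) = τ₀ + k * θ - (n + 1 / 2) := by
      rw [hτ₀]; push_cast; field_simp; ring
    rw [this, abs_le]
    constructor <;> linarith

theorem quarter_sub_le_sq {τ η : ℝ} {n : ℤ} (hη : 0 ≤ η) (h : |τ - (n + 1 / 2)| ≤ η) (k : ℤ) :
    1 / 4 - η ≤ (τ + k) ^ 2 := by
  rw [abs_le] at h
  rcases le_or_gt (1 / 2) η with h2 | h2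
  · nlinarith [sq_nonneg (τ + k)]
  rcases le_or_gt 0 (n + k) with h0 | h0
  · have : (0 : ℝ) ≤ n + k := by exact_mod_cast h0
    nlinarith
  · have : (n : ℝ) + k ≤ -1 := by exact_mod_cast Int.le_sub_one_of_lt h0
    nlinarith

/-- A planar lattice with basis `e`, `f` in which the orthogonal projection of `f` to `e` is close
to an odd multiple of `e / 2`, and whose covolume is at least that of the hexagonal lattice of
minimum `δ ≥ |e|`, has no vector outside `ℤ e` much shorter than `δ`. -/
theorem le_quadratic_of_half_shift {a c δ η τ : ℝ} {e f : Fin 2 → ℝ} {n : ℤ} (hη : 0 ≤ η)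
    (hG : 0 < a * e 0 ^ 2 + c * e 1 ^ 2) (hGδ : a * e 0 ^ 2 + c * e 1 ^ 2 ≤ δ ^ 2)
    (hτ : a * (e 0 * f 0) + c * (e 1 * f 1) = τ * (a * e 0 ^ 2 + c * e 1 ^ 2))
    (hn : |τ - (n + 1 / 2)| ≤ η)
    (hdet : 3 * δ ^ 4 ≤ 4 * (a * c * (e 0 * f 1 - e 1 * f 0) ^ 2)) (i j : ℤ) (hj : j ≠ 0) :
    (1 - η) * δ ^ 2 ≤ a * (i * e 0 + j * f 0) ^ 2 + c * (i * e 1 + j * f 1) ^ 2 := by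
  set G := a * e 0 ^ 2 + c * e 1 ^ 2 with hGdef
  set W := a * (i * e 0 + j * f 0) ^ 2 + c * (i * e 1 + j * f 1) ^ 2 with hW
  set d := a * c * (e 0 * f 1 - e 1 * f 0) ^ 2 with hd
  have key : G * W = G ^ 2 * (i + j * τ) ^ 2 + (j : ℝ) ^ 2 * d := by
    have h1 : G * W = (i * G + j * (a * (e 0 * f 0) + c * (e 1 * f 1))) ^ 2 + (j : ℝ) ^ 2 * d := by
      rw [hW, hd, hGdef]; ring
    rw [h1, hτ]; ring
  refine le_of_mul_le_mul_left ?_ hG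
  rw [key]
  have hd0 : 0 ≤ d := by nlinarith [pow_nonneg (sq_nonneg δ) 2]
  by_cases h1 : j = 1 ∨ j = -1
  · have hj2 : (j : ℝ) ^ 2 = 1 := by rcases h1 with rfl | rfl <;> norm_num
    have hq : 1 / 4 - η ≤ (i + j * τ) ^ 2 := by
      rcases h1 with rfl | rfl
      · have := quarter_sub_le_sq hη hn i
        push_cast; convert this using 1; ring
      · have := quarter_sub_le_sq hη hn (-i)
        push_cast at this ⊢; convert this using 1; ring
    rw [hj2]
    have h2 : G ^ 2 * (1 / 4 - η) ≤ G ^ 2 * (i + j * τ) ^ 2 := by gcongr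
    -- `G / 4 + 3 * δ ^ 4 / (4 * G) ≥ δ ^ 2` for `0 < G ≤ δ ^ 2`, as the hexagonal case `G = δ ^ 2`
    -- is extremal
    have h3 : 0 ≤ (δ ^ 2 - G) * (3 * δ ^ 2 - G) := mul_nonneg (by linarith) (by linarith)
    have h4 : 0 ≤ η * (G * (δ ^ 2 - G)) := by
      have : 0 ≤ δ ^ 2 - G := by linarith
      positivity
    nlinarith
  · have hj4 : (4 : ℝ) ≤ (j : ℝ) ^ 2 := by
      have : (4 : ℤ) ≤ j ^ 2 := by
        have : 2 ≤ j ∨ j ≤ -2 := by omega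
        rcases this with h | h <;> nlinarith
      exact_mod_cast this
    have h2 : 4 * d ≤ (j : ℝ) ^ 2 * d := by gcongr
    have h3 : 0 ≤ G ^ 2 * (i + j * τ) ^ 2 := by positivity
    have h4 : G * δ ^ 2 ≤ δ ^ 2 * δ ^ 2 := by gcongr
    have h5 : 0 ≤ η * (G * δ ^ 2) := by positivity
    nlinarith [mul_nonneg hG.le (sq_nonneg δ)]

/-! ### Integer vectors and their defects -/

/-- The first two coordinates of the vector of the lattice of `ξ` with integer coordinates `u`. -/
noncomputable def defect (ξ : Fin 2 → ℝ) (u : Fin 3 → ℤ) : Fin 2 → ℝ :=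
  ![u 2 * ξ 0 - u 0, u 2 * ξ 1 - u 1]

/-- The rational point of the plane with projective integer coordinates `v`. -/
noncomputable def ratPoint (v : Fin 3 → ℤ) : Fin 2 → ℝ := ![v 0 / v 2, v 1 / v 2]

theorem defect_combination (ξ : Fin 2 → ℝ) (i j k : ℤ) (x y z : Fin 3 → ℤ) (l : Fin 2) :
    defect ξ (i • x + j • y + k • z) l = i * defect ξ x l + j * defect ξ y l + k * defect ξ z l := by
  fin_cases l <;> simp [defect] <;> ring

theorem defect_ratPoint_self {v : Fin 3 → ℤ} (hv : v 2 ≠ 0) : defect (ratPoint v) v = 0 := by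
  have : (v 2 : ℝ) ≠ 0 := by exact_mod_cast hv
  ext l; fin_cases l <;> simp [defect, ratPoint] <;> field_simp <;> ring

/-- The defects with respect to `ratPoint v` span the projection of `ℤ³` along `v`, a planar lattice
of covolume `1 / v 2`. -/
theorem det_defect {v : Fin 3 → ℤ} (hv : v 2 ≠ 0) (x y : Fin 3 → ℤ) :
    (v 2 : ℝ) * (defect (ratPoint v) x 0 * defect (ratPoint v) y 1 -
      defect (ratPoint v) x 1 * defect (ratPoint v) y 0) =
      ((Matrix.of ![v, x, y]).det : ℤ) := by
  have : (v 2 : ℝ) ≠ 0 := by exact_mod_cast hv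
  simp [defect, ratPoint, Matrix.det_fin_three]
  field_simp
  ring

/-- Integer rows of determinant one form a basis of `ℤ³`. -/
theorem exists_combination {x y z : Fin 3 → ℤ} (h : (Matrix.of ![x, y, z]).det = 1)
    (u : Fin 3 → ℤ) : ∃ i j k : ℤ, u = i • x + j • y + k • z := by
  have h1 : (Matrix.of ![x, y, z]).transpose.mulVec
      ((Matrix.of ![x, y, z]).transpose.adjugate.mulVec u) = u := by
    rw [Matrix.mulVec_mulVec, Matrix.mul_adjugate, Matrix.det_transpose, h, one_smul,
      Matrix.one_mulVec]
  set w := (Matrix.of ![x, y, z]).transpose.adjugate.mulVec u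
  refine ⟨w 0, w 1, w 2, ?_⟩
  rw [← h1]
  ext l
  simp [Matrix.mulVec, dotProduct, Fin.sum_univ_three]
  ring

/-! ### The next approximation -/

/-- For vectors with inner products `F = ⟨l₁, l₁⟩`, `P = ⟨l₁, l₂⟩`, `G = ⟨l₂, l₂⟩` and
`L = l₁ + B l₂`, the ratio `⟨L, l₂⟩ / ⟨L, L⟩` is of order `1 / B`. -/
theorem inner_ratio_bounds {F P G B : ℝ} (hF : 0 ≤ F) (hG : 0 < G) (hB : 1 ≤ B)
    (hP : 3 * |P| ≤ B * G) (hFB : F ≤ B * G) :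
    0 < F + 2 * B * P + B ^ 2 * G ∧ (P + B * G) / (F + 2 * B * P + B ^ 2 * G) ≤ 2 / B ∧
      1 / (2 * B) ≤ (P + B * G) / (F + 2 * B * P + B ^ 2 * G) := by
  have hB0 : 0 < B := by linarith
  have h1 : B * (3 * |P|) ≤ B * (B * G) := by gcongr
  have h2 : B * -|P| ≤ B * P := by gcongr; exact neg_abs_le P
  have h3 : 0 < B * (B * G) := by positivity
  have h4 : 0 < F + 2 * B * P + B ^ 2 * G := by linarith
  have h5 : 1 * (B * G) ≤ B * (B * G) := by gcongr
  refine ⟨h4, ?_, ?_⟩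
  · rw [div_le_div_iff₀ h4 hB0]; linarith
  · rw [div_le_div_iff₀ (by positivity) h4]; linarith

/-- Choice of the coefficients of the next vector `m v + x + B y`, where `l₁`, `l₂` are the defects
of `x`, `y` at `ratPoint v`, `q` is the last coordinate of `v`, and `Q` that of the next vector. The
size condition `s Q ≈ q ^ 2 N(L) ^ 2` leaves of the order of `B ^ 2` values of `m`, while changing `m`
by one moves the shift by `θ`, of order `1 / B`; so the shift can be brought close to a half-odd
number. -/
theorem exists_coefficients (N : Seminorm ℝ (Fin 2 → ℝ)) {a c s q : ℝ} (ha : 0 < a) (hc : 0 < c)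
    (hs : 0 < s) (hq : 0 < q) {l₁ l₂ : Fin 2 → ℝ} (hG : 0 < a * l₂ 0 ^ 2 + c * l₂ 1 ^ 2)
    (hN : 0 < N l₂) {ε ρ : ℝ} (hε : 0 < ε) (hρ : 0 < ρ) (x₂ y₂ : ℝ) :
    ∃ (B : ℕ) (m n : ℤ) (L : Fin 2 → ℝ) (Q θ : ℝ), L = l₁ + (B : ℝ) • l₂ ∧
      Q = m * q + (x₂ + B * y₂) ∧ 0 < a * L 0 ^ 2 + c * L 1 ^ 2 ∧
      a * (L 0 * l₂ 0) + c * (L 1 * l₂ 1) = θ * (a * L 0 ^ 2 + c * L 1 ^ 2) ∧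
      q < Q ∧ ‖L‖ ≤ Q * ρ ∧ q ^ 2 * N L ^ 2 < s * Q ∧ s * Q ≤ q ^ 2 * N L ^ 2 * (1 + ε) ∧
      |Q / q * θ - y₂ / q - (n + 1 / 2)| ≤ ε := by
  obtain ⟨F, hF⟩ : ∃ F, F = a * l₁ 0 ^ 2 + c * l₁ 1 ^ 2 := ⟨_, rfl⟩
  obtain ⟨P, hP⟩ : ∃ P, P = a * (l₁ 0 * l₂ 0) + c * (l₁ 1 * l₂ 1) := ⟨_, rfl⟩
  obtain ⟨G₂, hG₂⟩ : ∃ G₂, G₂ = a * l₂ 0 ^ 2 + c * l₂ 1 ^ 2 := ⟨_, rfl⟩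
  rw [← hG₂] at hG
  have hF0 : 0 ≤ F := by rw [hF]; positivity
  obtain ⟨κ, hκ⟩ : ∃ κ, κ = q ^ 2 * N l₂ ^ 2 / 4 := ⟨_, rfl⟩
  have hκ0 : 0 < κ := by rw [hκ]; positivity
  obtain ⟨B, hB1, hBP, hBF, hBn, hBε, hBw, hBρ, hBq⟩ : ∃ B : ℕ, (1 : ℝ) ≤ B ∧
      3 * |P| / G₂ ≤ B ∧ F / G₂ ≤ B ∧ 2 * N l₁ / N l₂ ≤ B ∧ 2 / ε ≤ B ∧
      4 * q * s / (ε * κ) ≤ B ∧ (‖l₁‖ + ‖l₂‖) * s / (ρ * κ) ≤ B ∧ q * s / κ ≤ B := by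
    have h (K : ℝ) : ∀ᶠ B : ℕ in atTop, K ≤ (B : ℝ) :=
      tendsto_natCast_atTop_atTop.eventually (eventually_ge_atTop K)
    exact ((h _).and <| (h _).and <| (h _).and <| (h _).and <| (h _).and <| (h _).and <|
      (h _).and (h _)).exists
  have hB0 : (0 : ℝ) < B := by linarith
  rw [div_le_iff₀ hG] at hBP hBF
  rw [div_le_iff₀ hN] at hBn
  rw [div_le_iff₀ hε] at hBε
  rw [div_le_iff₀ (by positivity)] at hBw hBρ hBq
  obtain ⟨L, hL⟩ : ∃ L : Fin 2 → ℝ, L = l₁ + (B : ℝ) • l₂ := ⟨_, rfl⟩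
  have hL0 (l : Fin 2) : L l = l₁ l + B * l₂ l := by simp [hL]
  have hGe : a * L 0 ^ 2 + c * L 1 ^ 2 = F + 2 * B * P + B ^ 2 * G₂ := by
    rw [hL0, hL0, hF, hP, hG₂]; ring
  have hLl : a * (L 0 * l₂ 0) + c * (L 1 * l₂ 1) = P + B * G₂ := by
    rw [hL0, hL0, hP, hG₂]; ring
  obtain ⟨hG0, hθ2, hθ1⟩ := inner_ratio_bounds hF0 hG hB1 hBP hBF
  rw [← hGe] at hG0 hθ2 hθ1
  obtain ⟨θ, hθ⟩ : ∃ θ, θ = (P + B * G₂) / (a * L 0 ^ 2 + c * L 1 ^ 2) := ⟨_, rfl⟩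
  rw [← hθ] at hθ2 hθ1
  have hθ0 : 0 < θ := lt_of_lt_of_le (by positivity) hθ1
  have hNL : B * N l₂ / 2 ≤ N L := by
    have h1 : N ((B : ℝ) • l₂) ≤ N L + N l₁ := by
      have : (B : ℝ) • l₂ = L - l₁ := by rw [hL]; abel
      rw [this]; exact map_sub_le_add N L l₁
    rw [map_smul_eq_mul, Real.norm_of_nonneg hB0.le] at h1
    linarith
  obtain ⟨X, hX⟩ : ∃ X, X = q ^ 2 * N L ^ 2 := ⟨_, rfl⟩
  have hXκ : B * (κ * B) ≤ X := by
    calc B * (κ * B) = q ^ 2 * (B * N l₂ / 2) ^ 2 := by rw [hκ]; ring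
      _ ≤ q ^ 2 * N L ^ 2 := by gcongr
      _ = X := hX.symm
  have hX0 : 0 < X := lt_of_lt_of_le (by positivity) hXκ
  obtain ⟨m, n, hm1, hm2, hm3⟩ := exists_int_window hq hθ0 (x₂ + B * y₂) (X / s) (y₂ / q)
  obtain ⟨Q, hQ⟩ : ∃ Q, Q = m * q + (x₂ + B * y₂) := ⟨_, rfl⟩
  rw [← hQ] at hm1 hm2 hm3
  have hXQ : X < s * Q := by rwa [div_lt_iff₀' hs] at hm1
  refine ⟨B, m, n, L, Q, θ, hL, hQ, hG0, ?_, ?_, ?_, hX ▸ hXQ, hX ▸ ?_, hm3.trans (hθ2.trans ?_)⟩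
  · rw [hLl, hθ, div_mul_cancel₀ _ hG0.ne']
  · have h1 : q * s * 1 ≤ B * κ * B := by gcongr
    refine lt_of_mul_lt_mul_left ?_ hs.le
    linarith
  · have h2 : ‖L‖ ≤ ‖l₁‖ + B * ‖l₂‖ := by
      rw [hL]
      refine (norm_add_le _ _).trans ?_
      rw [norm_smul, Real.norm_of_nonneg hB0.le]
    have h3 : ‖l₁‖ * 1 ≤ ‖l₁‖ * B := by gcongr
    have h4 : B * ((‖l₁‖ + ‖l₂‖) * s) ≤ B * (B * (ρ * κ)) := by gcongr
    have h5 : ρ * (B * (κ * B)) ≤ ρ * (s * Q) :=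
      mul_le_mul_of_nonneg_left (hXκ.trans hXQ.le) hρ.le
    have h6 : s * ‖L‖ ≤ s * ((‖l₁‖ + ‖l₂‖) * B) := by gcongr; linarith
    refine le_of_mul_le_mul_left ?_ hs
    linarith
  · have h1 : 1 / θ ≤ 2 * B := by
      rw [div_le_iff₀ hθ0]
      rw [div_le_iff₀ (by positivity)] at hθ1; linarith
    have h2 : s * Q ≤ X + s * (q * (2 + 1 / θ)) := by
      have := mul_le_mul_of_nonneg_left hm2 hs.le
      rwa [mul_add, mul_div_cancel₀ _ hs.ne'] at this
    have h3 : s * (q * (2 + 1 / θ)) ≤ s * (q * (4 * B)) := by gcongr; linarith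
    have h4 : B * (4 * q * s) ≤ B * (B * (ε * κ)) := by gcongr
    have h5 : ε * (B * (κ * B)) ≤ ε * X := by gcongr
    linarith
  · rw [div_le_iff₀ hB0]; linarith

/-- The inductive step. Here `y` and `x` are the two predecessors of `v`, and `v'` is its successor.
At the rational point of `v'`, the vector `v` realizes the value `s` of (defect)² × (denominator of
`v'`) up to the factor `1 - ε`, and up to the same factor no integer vector with denominator below
that of `v'` has a smaller defect than `v`. -/
theorem exists_next (N : Seminorm ℝ (Fin 2 → ℝ)) {a c s : ℝ} (ha : 0 < a) (hc : 0 < c)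
    (hE : ∀ u : Fin 2 → ℝ, a * u 0 ^ 2 + c * u 1 ^ 2 ≤ N u ^ 2) (hs : 0 < s)
    (hsE : 3 * s ^ 2 ≤ 4 * (a * c)) {v x y : Fin 3 → ℤ} (hv : 0 < v 2)
    (hdet : (Matrix.of ![v, x, y]).det = 1) {ε ρ : ℝ} (hε : 0 < ε) (hε1 : ε < 1) (hρ : 0 < ρ) :
    ∃ v' : Fin 3 → ℤ, (Matrix.of ![v', y, v]).det = 1 ∧ v 2 < v' 2 ∧
      ‖ratPoint v' - ratPoint v‖ ≤ ρ ∧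
      N (defect (ratPoint v') v) ^ 2 * v' 2 < s ∧
      s * (1 - ε) ≤ N (defect (ratPoint v') v) ^ 2 * v' 2 ∧
      ∀ u : Fin 3 → ℤ, u ≠ 0 → |u 2| < v' 2 →
        (1 - ε) * N (defect (ratPoint v') v) ≤ N (defect (ratPoint v') u) := by
  obtain ⟨q, hqv⟩ : ∃ q : ℝ, q = v 2 := ⟨_, rfl⟩
  have hq : 0 < q := by rw [hqv]; exact_mod_cast hv
  obtain ⟨l₁, hl₁⟩ : ∃ l, l = defect (ratPoint v) x := ⟨_, rfl⟩
  obtain ⟨l₂, hl₂⟩ : ∃ l, l = defect (ratPoint v) y := ⟨_, rfl⟩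
  have hl : q * (l₁ 0 * l₂ 1 - l₁ 1 * l₂ 0) = 1 := by
    rw [hqv, hl₁, hl₂, det_defect hv.ne', hdet]; simp
  have hG₂ : 0 < a * l₂ 0 ^ 2 + c * l₂ 1 ^ 2 := by
    rcases eq_or_ne (l₂ 0) 0 with h0 | h0
    · rcases eq_or_ne (l₂ 1) 0 with h1 | h1
      · rw [h0, h1] at hl; norm_num at hl
      · positivity
    · positivity
  have hn₂ : 0 < N l₂ := by
    refine lt_of_le_of_ne (apply_nonneg N l₂) fun h => ?_
    have h1 := hE l₂
    rw [← h] at h1; linarith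
  obtain ⟨B, m, n, L, Q, θ, hL, hQ, hG0, hLl, hqQ, hLρ, hXQ, hwin, hshift⟩ :=
    exists_coefficients N ha hc hs hq (l₁ := l₁) hG₂ hn₂ hε hρ (x 2) (y 2)
  have hQ0 : 0 < Q := hq.trans hqQ
  obtain ⟨v', hv'⟩ : ∃ v' : Fin 3 → ℤ, v' = m • v + (1 : ℤ) • x + (B : ℤ) • y := ⟨_, rfl⟩
  have hQv' : Q = v' 2 := by
    rw [hQ, hv', hqv]; simp; ring
  have hQv : 0 < v' 2 := by
    have : (0 : ℝ) < v' 2 := hQv' ▸ hQ0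
    exact_mod_cast this
  have hDet' : (Matrix.of ![v', y, v]).det = 1 := by
    rw [← hdet, hv']; simp [Matrix.det_fin_three]; ring
  have hLv' (l : Fin 2) : defect (ratPoint v) v' l = L l := by
    rw [hv', defect_combination, defect_ratPoint_self hv.ne', hL]; simp [hl₁, hl₂]
  have hξ (l : Fin 2) : ratPoint v' l = ratPoint v l - L l / Q := by
    have hQ0' : (v' 2 : ℝ) ≠ 0 := hQv' ▸ hQ0.ne'
    rw [← hLv' l, hQv']
    fin_cases l <;> simp [defect, ratPoint] <;> field_simp <;> ring
  have hdef (u : Fin 3 → ℤ) (l : Fin 2) :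
      defect (ratPoint v') u l = defect (ratPoint v) u l - u 2 / Q * L l := by
    have h0 := hξ 0
    have h1 := hξ 1
    fin_cases l
    · simp only [defect, Fin.zero_eta, Matrix.cons_val_zero, h0]; ring
    · simp only [defect, Fin.mk_one, Matrix.cons_val_one, Matrix.cons_val_zero, h1]; ring
  -- `e` and `f` form a basis of the projection of `ℤ³` along `v'`
  obtain ⟨e, he⟩ : ∃ e, e = defect (ratPoint v') v := ⟨_, rfl⟩
  obtain ⟨f, hf⟩ : ∃ f, f = defect (ratPoint v') y := ⟨_, rfl⟩
  have he' (l : Fin 2) : e l = -(q / Q) * L l := by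
    rw [he, hdef, defect_ratPoint_self hv.ne', ← hqv]; simp
  have hf' (l : Fin 2) : f l = l₂ l - y 2 / Q * L l := by rw [hf, hdef, hl₂]
  have hNe : N e = q / Q * N L := by
    have : e = (-(q / Q)) • L := by ext l; simp [he']
    rw [this, map_smul_eq_mul, norm_neg, Real.norm_of_nonneg (by positivity)]
  have hNQ : N e ^ 2 * Q = q ^ 2 * N L ^ 2 / Q := by
    rw [hNe]; field_simp
  have hnQ : N e ^ 2 * Q < s := by
    rw [hNQ, div_lt_iff₀ hQ0]; exact hXQ
  have hNe0 := apply_nonneg N e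
  refine ⟨v', hDet', ?_, ?_, ?_⟩
  · have : (v 2 : ℝ) < v' 2 := by rwa [← hqv, ← hQv']
    exact_mod_cast this
  · have h1 : ratPoint v' - ratPoint v = (-(1 / Q)) • L := by
      ext l; simp only [Pi.sub_apply, hξ, Pi.smul_apply, smul_eq_mul]; ring
    rw [h1, norm_smul, norm_neg, Real.norm_of_nonneg (by positivity), one_div,
      inv_mul_le_iff₀ hQ0]
    exact hLρ
  rw [← he, ← hQv']
  refine ⟨hnQ, ?_, ?_⟩
  · rw [hNQ, le_div_iff₀ hQ0]
    have h1 : s * Q * (1 - ε) ≤ q ^ 2 * N L ^ 2 * (1 + ε) * (1 - ε) := by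
      gcongr
    have h2 : 0 ≤ q ^ 2 * N L ^ 2 * (ε * ε) := by positivity
    linarith
  · intro u hu hu2
    obtain ⟨i, j, k, rfl⟩ := exists_combination hDet' u
    have hw (l : Fin 2) :
        defect (ratPoint v') (i • v' + j • y + k • v) l = k * e l + j * f l := by
      rw [defect_combination, defect_ratPoint_self hQv.ne']; simp [he, hf]; ring
    generalize defect (ratPoint v') (i • v' + j • y + k • v) = w at hw ⊢
    rcases eq_or_ne j 0 with rfl | hj
    · rcases eq_or_ne k 0 with rfl | hk
      · have hi : i ≠ 0 := by rintro rfl; simp at hu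
        have h1 : 1 ≤ |i| := Int.one_le_abs hi
        simp [abs_mul, abs_of_pos hQv] at hu2
        nlinarith
      · have hwe : w = (k : ℝ) • e := by ext l; simp [hw]
        have hk1 : (1 : ℝ) ≤ |(k : ℝ)| := by exact_mod_cast Int.one_le_abs hk
        rw [hwe, map_smul_eq_mul, Real.norm_eq_abs]
        exact mul_le_mul_of_nonneg_right (by linarith) hNe0
    · have hGE : a * e 0 ^ 2 + c * e 1 ^ 2 = (q / Q) ^ 2 * (a * L 0 ^ 2 + c * L 1 ^ 2) := by
        rw [he', he']; ring
      have hD : Q * (f 0 * e 1 - f 1 * e 0) = 1 := by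
        rw [hQv', hf, he, det_defect hQv.ne', hDet']; simp
      have main := le_quadratic_of_half_shift (a := a) (c := c) (δ := N e) (η := ε)
        (τ := -(Q / q * θ - y 2 / q)) (e := e) (f := f) (n := -n - 1) hε.le
        (by rw [hGE]; positivity) (hE e) ?_ ?_ ?_ k j hj
      · have h1 : ((1 - ε) * N e) ^ 2 ≤ N w ^ 2 := by
          refine le_trans ?_ (hE w)
          rw [hw, hw]
          refine le_trans ?_ main
          have h2 : 0 ≤ ε * (1 - ε) * N e ^ 2 :=
            mul_nonneg (mul_nonneg hε.le (by linarith)) (sq_nonneg _)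
          linarith
        exact le_of_sq_le_sq h1 (apply_nonneg N w)
      · rw [hGE, he', he', hf', hf']
        have : a * (-(q / Q) * L 0 * (l₂ 0 - y 2 / Q * L 0)) +
            c * (-(q / Q) * L 1 * (l₂ 1 - y 2 / Q * L 1)) =
            -(q / Q) * ((a * (L 0 * l₂ 0) + c * (L 1 * l₂ 1)) -
              y 2 / Q * (a * L 0 ^ 2 + c * L 1 ^ 2)) := by
          ring
        rw [this, hLl]
        field_simp
      · have h1 : -(Q / q * θ - y 2 / q) - (((-n - 1 : ℤ) : ℝ) + 1 / 2) =
            -(Q / q * θ - y 2 / q - (n + 1 / 2)) := by push_cast; ring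
        rw [h1, abs_neg]
        exact hshift
      · have h1 : (N e ^ 2 * Q) ^ 2 ≤ s ^ 2 := by gcongr
        have h2 : Q ^ 2 * (e 0 * f 1 - e 1 * f 0) ^ 2 = 1 := by
          calc _ = (Q * (f 0 * e 1 - f 1 * e 0)) ^ 2 := by ring
            _ = 1 := by rw [hD]; norm_num
        have h3 : Q ^ 2 * (3 * N e ^ 4) ≤
            Q ^ 2 * (4 * (a * c * (e 0 * f 1 - e 1 * f 0) ^ 2)) := by
          calc Q ^ 2 * (3 * N e ^ 4) = 3 * (N e ^ 2 * Q) ^ 2 := by ring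
            _ ≤ 4 * (a * c) * (Q ^ 2 * (e 0 * f 1 - e 1 * f 0) ^ 2) := by rw [h2]; linarith
            _ = _ := by ring
        exact le_of_mul_le_mul_left h3 (by positivity)

/-! ### Lattices of simultaneous approximations -/

/-- A basis, in its rows, of the lattice of simultaneous approximations to `ξ`, moved by time `t`
under the diagonal flow. -/
noncomputable def approxBasis (ξ : Fin 2 → ℝ) (t : ℝ) : Fin 3 → Fin 3 → ℝ :=
  ![![-Real.exp t, 0, 0], ![0, -Real.exp t, 0],
    ![Real.exp t * ξ 0, Real.exp t * ξ 1, Real.exp (-2 * t)]]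

/-- The image at time `t` under the diagonal flow of the lattice of all `(q ξ - p, q)` with
`p ∈ ℤ²` and `q ∈ ℤ`. -/
noncomputable def approxLattice (ξ : Fin 2 → ℝ) (t : ℝ) : Submodule ℤ (Fin 3 → ℝ) :=
  Submodule.span ℤ (Set.range (approxBasis ξ t))

/-- The vector of `approxLattice ξ t` with integer coordinates `u`. -/
noncomputable def approxVector (ξ : Fin 2 → ℝ) (t : ℝ) (u : Fin 3 → ℤ) : Fin 3 → ℝ :=
  ![Real.exp t * defect ξ u 0, Real.exp t * defect ξ u 1, Real.exp (-2 * t) * u 2]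

theorem sum_approxBasis (ξ : Fin 2 → ℝ) (t : ℝ) (u : Fin 3 → ℤ) :
    ∑ i, u i • approxBasis ξ t i = approxVector ξ t u := by
  ext l
  fin_cases l <;> simp [Fin.sum_univ_three, approxBasis, approxVector, defect] <;> ring

theorem mem_approxLattice {ξ : Fin 2 → ℝ} {t : ℝ} {w : Fin 3 → ℝ} :
    w ∈ approxLattice ξ t ↔ ∃ u : Fin 3 → ℤ, approxVector ξ t u = w := by
  simp only [approxLattice, Submodule.mem_span_range_iff_exists_fun, sum_approxBasis]

theorem approxVector_eq_zero {ξ : Fin 2 → ℝ} {t : ℝ} {u : Fin 3 → ℤ} :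
    approxVector ξ t u = 0 ↔ u = 0 := by
  constructor
  · intro h
    have h0 := congrFun h 0
    have h1 := congrFun h 1
    have h2 := congrFun h 2
    simp [approxVector, defect] at h0 h1 h2
    simp [h2] at h0 h1
    ext l; fin_cases l <;> simp [h0, h1, h2]
  · rintro rfl
    ext l; fin_cases l <;> simp [approxVector, defect]

theorem det_approxBasis (ξ : Fin 2 → ℝ) (t : ℝ) : (Matrix.of (approxBasis ξ t)).det = 1 := by
  simp [approxBasis, Matrix.det_fin_three]
  rw [← Real.exp_add, ← Real.exp_add]; simp; ring

/-- The rows of a real matrix of determinant one span a lattice of covolume one. -/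
theorem span_range_mem_unimodularLattices {A : Fin 3 → Fin 3 → ℝ} (h : (Matrix.of A).det = 1) :
    Submodule.span ℤ (Set.range A) ∈ unimodularLattices := by
  have hA : (Pi.basisFun ℝ (Fin 3)).det A = 1 := by rw [Pi.basisFun_det_apply]; exact h
  obtain ⟨hli, hsp⟩ := (Module.Basis.is_basis_iff_det (Pi.basisFun ℝ (Fin 3)) (v := A)).2
    (by rw [hA]; exact isUnit_one)
  set b : Module.Basis (Fin 3) ℝ (Fin 3 → ℝ) := Module.Basis.mk hli hsp.ge with hb
  have hbA : (b : Fin 3 → Fin 3 → ℝ) = A := Module.Basis.coe_mk _ _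
  rw [← hbA] at h ⊢
  refine ⟨inferInstance, inferInstance, ?_⟩
  rw [ZLattice.covolume_eq_measure_fundamentalDomain _ _
    (ZSpan.isAddFundamentalDomain b MeasureTheory.volume), ZSpan.volume_real_fundamentalDomain, h,
    abs_one]

theorem approxLattice_mem (ξ : Fin 2 → ℝ) (t : ℝ) : approxLattice ξ t ∈ unimodularLattices :=
  span_range_mem_unimodularLattices (det_approxBasis ξ t)

theorem flow_approxLattice (ξ : Fin 2 → ℝ) (s t : ℝ) :
    flow t (approxLattice ξ s) = approxLattice ξ (s + t) := by
  rw [flow, approxLattice, Submodule.map_span, ← Set.range_comp, approxLattice]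
  congr 2
  ext i l
  have h1 : Real.exp (-(2 * t)) * Real.exp (-(2 * s)) = Real.exp (-(2 * (s + t))) := by
    rw [← Real.exp_add]; ring_nf
  have h2 : Real.exp t * Real.exp s = Real.exp (s + t) := by
    rw [← Real.exp_add]; ring_nf
  fin_cases i <;> fin_cases l <;>
    simp [approxBasis, flowMatrix, Matrix.mulVec_diagonal, ← h1, ← h2, mul_assoc]

theorem approxLattice_injective (ξ : Fin 2 → ℝ) : Function.Injective (approxLattice ξ) := by
  -- the shortest horizontal vectors of `approxLattice ξ t` have length `exp t`
  have key (s t : ℝ) (h : approxLattice ξ s = approxLattice ξ t) : Real.exp t ≤ Real.exp s := by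
    have h1 : approxVector ξ s ![-1, 0, 0] ∈ approxLattice ξ t :=
      h ▸ mem_approxLattice.2 ⟨_, rfl⟩
    obtain ⟨u, hu⟩ := mem_approxLattice.1 h1
    have h0 := congrFun hu 0
    have h2 := congrFun hu 2
    simp [approxVector, defect] at h0 h2
    simp [h2] at h0
    have h3 : (0 : ℝ) < -u 0 := by
      by_contra h3
      nlinarith [Real.exp_pos s, Real.exp_pos t]
    have h4 : (1 : ℝ) ≤ -u 0 := by
      have : 0 < -u 0 := by exact_mod_cast h3
      exact_mod_cast this
    nlinarith [Real.exp_pos t]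
  intro s t h
  exact Real.exp_injective (le_antisymm (key t s h.symm) (key s t h))

/-- Lattices are finitely generated, so there are at most continuum many. -/
theorem mk_unimodularLattices_le : #unimodularLattices ≤ 𝔠 := by
  have h : unimodularLattices ⊆
      Set.range (fun S : Finset (Fin 3 → ℝ) => Submodule.span ℤ (S : Set (Fin 3 → ℝ))) := by
    rintro L ⟨hd, hz, -⟩
    obtain ⟨S, hS⟩ := ZLattice.FG ℝ L
    exact ⟨S, hS⟩
  refine (mk_le_mk_of_subset h).trans (mk_range_le.trans ?_)
  rw [mk_finset_of_infinite]
  simp only [mk_pi, mk_real, prod_const, lift_id, mk_fin]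
  exact_mod_cast power_nat_le (n := 3) aleph0_le_continuum

theorem starNorm_nonneg (N : Seminorm ℝ (Fin 2 → ℝ)) (u : Fin 3 → ℝ) : 0 ≤ starNorm N u :=
  (apply_nonneg N _).trans (le_max_left _ _)

theorem starNorm_approxVector (N : Seminorm ℝ (Fin 2 → ℝ)) (ξ : Fin 2 → ℝ) (t : ℝ)
    (u : Fin 3 → ℤ) : starNorm N (approxVector ξ t u) =
      max (Real.exp t * N (defect ξ u)) (Real.exp (-2 * t) * |(u 2 : ℝ)|) := by
  have : ![Real.exp t * defect ξ u 0, Real.exp t * defect ξ u 1] = Real.exp t • defect ξ u := by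
    ext l; fin_cases l <;> simp
  simp only [starNorm, approxVector, Matrix.cons_val_zero, Matrix.cons_val_one, Matrix.cons_val,
    this, map_smul_eq_mul, abs_mul, Real.norm_eq_abs, Real.abs_exp]

theorem firstMinimum_le (N : Seminorm ℝ (Fin 2 → ℝ)) (ξ : Fin 2 → ℝ) (t : ℝ) {u : Fin 3 → ℤ}
    (hu : u ≠ 0) : firstMinimum N (approxLattice ξ t) ≤
      max (Real.exp t * N (defect ξ u)) (Real.exp (-2 * t) * |(u 2 : ℝ)|) := by
  rw [← starNorm_approxVector]
  refine csInf_le ⟨0, ?_⟩ ⟨_, ⟨mem_approxLattice.2 ⟨u, rfl⟩, ?_⟩, rfl⟩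
  · rintro _ ⟨w, -, rfl⟩; exact starNorm_nonneg N w
  · rwa [Ne, approxVector_eq_zero]

theorem le_firstMinimum (N : Seminorm ℝ (Fin 2 → ℝ)) {ξ : Fin 2 → ℝ} {t m : ℝ}
    (h : ∀ u : Fin 3 → ℤ, u ≠ 0 →
      m ≤ max (Real.exp t * N (defect ξ u)) (Real.exp (-2 * t) * |(u 2 : ℝ)|)) :
    m ≤ firstMinimum N (approxLattice ξ t) := by
  refine le_csInf ?_ ?_
  · refine ⟨_, _, ⟨mem_approxLattice.2 ⟨![1, 0, 0], rfl⟩, ?_⟩, rfl⟩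
    rw [Ne, approxVector_eq_zero]
    intro h; simpa using congrFun h 0
  · rintro _ ⟨w, ⟨hw, hw0⟩, rfl⟩
    obtain ⟨u, rfl⟩ := mem_approxLattice.1 hw
    rw [starNorm_approxVector]
    exact h u (by rwa [Ne, approxVector_eq_zero] at hw0)

/-- Moving a lattice along the flow only shifts time, so it does not change the escape set. -/
theorem escapeSet_approxLattice (N : Seminorm ℝ (Fin 2 → ℝ)) (ξ : Fin 2 → ℝ) (s : ℝ) :
    escapeSet N (approxLattice ξ s) = escapeSet N (approxLattice ξ 0) := by
  have key (s t : ℝ) : escapeSet N (approxLattice ξ s) ⊆ escapeSet N (approxLattice ξ t) := by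
    rintro ε ⟨h0, h⟩
    refine ⟨h0, ?_⟩
    filter_upwards [(tendsto_atTop_add_const_left atTop (t - s) tendsto_id).eventually h] with τ hτ
    rw [flow_approxLattice] at hτ ⊢
    convert hτ using 3
    simp only [id]; ring
  exact (key s 0).antisymm (key 0 s)

/-- The lattices `approxLattice ξ s`, `s ∈ ℝ`, are distinct and have the same threshold, so one of
them with threshold `r` provides continuum many. -/
theorem mk_threshold_eq (N : Seminorm ℝ (Fin 2 → ℝ)) {ξ : Fin 2 → ℝ} {r : ℝ}
    (h : IsThreshold N (approxLattice ξ 0) r) :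
    #{L : Submodule ℤ (Fin 3 → ℝ) | L ∈ unimodularLattices ∧ IsThreshold N L r} = 𝔠 := by
  refine le_antisymm ((mk_le_mk_of_subset fun L hL => hL.1).trans mk_unimodularLattices_le) ?_
  rw [← mk_real]
  refine mk_le_of_injective (f := fun s : ℝ => ⟨approxLattice ξ s, approxLattice_mem ξ s, ?_⟩) ?_
  · rw [IsThreshold, escapeSet_approxLattice]; exact h
  · intro s t hst
    exact approxLattice_injective ξ (congrArg Subtype.val hst)

/-! ### Continuity of seminorms on the plane -/

theorem exists_pos_le_mul_norm (N : Seminorm ℝ (Fin 2 → ℝ)) : ∃ C, 0 < C ∧ ∀ u, N u ≤ C * ‖u‖ := by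
  refine ⟨N ![1, 0] + N ![0, 1] + 1, ?_, fun u => ?_⟩
  · have := apply_nonneg N ![1, 0]
    have := apply_nonneg N ![0, 1]
    linarith
  · have h : u = u 0 • ![1, 0] + u 1 • ![0, 1] := by ext l; fin_cases l <;> simp
    have h1 : N u ≤ |u 0| * N ![1, 0] + |u 1| * N ![0, 1] := by
      conv_lhs => rw [h]
      refine (map_add_le_add N _ _).trans (le_of_eq ?_)
      rw [map_smul_eq_mul, map_smul_eq_mul, Real.norm_eq_abs, Real.norm_eq_abs]
    have h2 : |u 0| * N ![1, 0] ≤ ‖u‖ * N ![1, 0] :=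
      mul_le_mul_of_nonneg_right (norm_le_pi_norm u 0) (apply_nonneg N _)
    have h3 : |u 1| * N ![0, 1] ≤ ‖u‖ * N ![0, 1] :=
      mul_le_mul_of_nonneg_right (norm_le_pi_norm u 1) (apply_nonneg N _)
    linarith [norm_nonneg u]

theorem continuous_seminorm (N : Seminorm ℝ (Fin 2 → ℝ)) : Continuous N := by
  obtain ⟨C, -, hC⟩ := exists_pos_le_mul_norm N
  refine Seminorm.continuous_of_continuousAt_zero ?_
  rw [ContinuousAt, map_zero]
  refine squeeze_zero (fun u => apply_nonneg N u) hC ?_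
  have : Continuous fun u : Fin 2 → ℝ => C * ‖u‖ := by fun_prop
  simpa using this.tendsto 0

/-! ### The limit point -/

theorem defect_sub_defect (ξ η : Fin 2 → ℝ) (u : Fin 3 → ℤ) :
    defect η u - defect ξ u = (u 2 : ℝ) • (η - ξ) := by
  ext l; fin_cases l <;> simp [defect] <;> ring

/-- `IsNearCritical N s ε v v' ξ` says that, for approximation to `ξ`, the square of the defect of
`v` times the denominator of `v'` is strictly below `s`, whereas for all nonzero integer vectors with
denominator below that of `v'` the same product is at least about `s`: at least
`(1 - ε) ^ 3 * s`, with `δ` in the role of the common lower bound of the defects. -/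
def IsNearCritical (N : Seminorm ℝ (Fin 2 → ℝ)) (s ε : ℝ) (v v' : Fin 3 → ℤ) (ξ : Fin 2 → ℝ) :
    Prop :=
  N (defect ξ v) ^ 2 * v' 2 < s ∧ ∃ δ : ℝ, 0 < δ ∧ s * (1 - ε) ≤ δ ^ 2 * v' 2 ∧
    ∀ u : Fin 3 → ℤ, u ≠ 0 → |u 2| < v' 2 → (1 - ε) * δ ≤ N (defect ξ u)

/-- The conclusion of `exists_next` persists on a small ball around the new rational point. -/
theorem exists_next_ball (N : Seminorm ℝ (Fin 2 → ℝ)) {a c s : ℝ} (ha : 0 < a) (hc : 0 < c)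
    (hE : ∀ u : Fin 2 → ℝ, a * u 0 ^ 2 + c * u 1 ^ 2 ≤ N u ^ 2) (hs : 0 < s)
    (hsE : 3 * s ^ 2 ≤ 4 * (a * c)) {v x y : Fin 3 → ℤ} (hv : 0 < v 2)
    (hdet : (Matrix.of ![v, x, y]).det = 1) {ε ρ : ℝ} (hε : 0 < ε) (hε1 : ε < 1) (hρ : 0 < ρ) :
    ∃ (v' : Fin 3 → ℤ) (ρ' : ℝ), 0 < ρ' ∧ (Matrix.of ![v', y, v]).det = 1 ∧ v 2 < v' 2 ∧
      Metric.closedBall (ratPoint v') ρ' ⊆ Metric.closedBall (ratPoint v) ρ ∧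
      ∀ ξ ∈ Metric.closedBall (ratPoint v') ρ', IsNearCritical N s ε v v' ξ := by
  obtain ⟨v', hdet', hlt, hnear, hsup, hinf, hmin⟩ :=
    exists_next N ha hc hE hs hsE hv hdet (half_pos hε) (by linarith : ε / 2 < 1) (half_pos hρ)
  obtain ⟨δ, hδ⟩ : ∃ δ, δ = N (defect (ratPoint v') v) := ⟨_, rfl⟩
  rw [← hδ] at hinf hmin
  have hv' : (0 : ℝ) < v' 2 := by exact_mod_cast hv.trans hlt
  have hδ0 : 0 < δ := by
    refine lt_of_le_of_ne (hδ ▸ apply_nonneg N _) fun h => ?_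
    rw [← h] at hinf
    have : 0 < s * (1 - ε / 2) := mul_pos hs (by linarith)
    linarith
  have hN := continuous_seminorm N
  have hd : Continuous fun ξ => N (defect ξ v) ^ 2 * v' 2 := by
    refine ((hN.comp ?_).pow 2).mul_const _
    refine continuous_pi fun l => ?_
    fin_cases l <;> simp [defect] <;> fun_prop
  have hc' : Continuous fun ξ => (v' 2 : ℝ) * N (ξ - ratPoint v') := by fun_prop
  have ev1 : ∀ᶠ ξ in nhds (ratPoint v'), N (defect ξ v) ^ 2 * v' 2 < s :=
    hd.continuousAt.eventually_lt continuousAt_const hsup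
  have ev2 : ∀ᶠ ξ in nhds (ratPoint v'), (v' 2 : ℝ) * N (ξ - ratPoint v') < ε / 2 * δ :=
    hc'.continuousAt.eventually_lt continuousAt_const (by simp; positivity)
  have ev3 : ∀ᶠ ξ in nhds (ratPoint v'), ξ ∈ Metric.closedBall (ratPoint v) ρ := by
    refine Metric.closedBall_mem_nhds_of_mem (Metric.mem_ball.2 ?_)
    rw [dist_eq_norm]; linarith
  obtain ⟨ρ', hρ', hball⟩ :=
    Metric.nhds_basis_closedBall.eventually_iff.1 (ev1.and (ev2.and ev3))
  refine ⟨v', ρ', hρ', hdet', hlt, fun ξ hξ => (hball hξ).2.2, fun ξ hξ => ?_⟩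
  obtain ⟨h1, h2, -⟩ := hball hξ
  refine ⟨h1, δ, hδ0, ?_, fun u hu hu2 => ?_⟩
  · have : 0 < s * ε := by positivity
    linarith
  · have h3 := hmin u hu hu2
    have h4 : N (defect (ratPoint v') u) ≤ N (defect ξ u) + |(u 2 : ℝ)| * N (ξ - ratPoint v') := by
      have h5 : defect (ratPoint v') u = defect ξ u - (u 2 : ℝ) • (ξ - ratPoint v') := by
        rw [← defect_sub_defect]; abel
      rw [h5, ← Real.norm_eq_abs, ← map_smul_eq_mul]
      exact map_sub_le_add N _ _
    have h6 : |(u 2 : ℝ)| * N (ξ - ratPoint v') ≤ v' 2 * N (ξ - ratPoint v') := by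
      gcongr; exact_mod_cast hu2.le
    linarith

/-- Three consecutive vectors of the sequence of approximations: `v` is the current one, `y` its
predecessor and `x` the predecessor of `y`. The radius `ρ` is that of a ball around the rational
point of `v` in which all later rational points stay. -/
structure ApproxState where
  v : Fin 3 → ℤ
  x : Fin 3 → ℤ
  y : Fin 3 → ℤ
  ρ : ℝ
  pos : 0 < v 2
  det : (Matrix.of ![v, x, y]).det = 1
  ρ_pos : 0 < ρ

/-- A point `ξ` in the intersection of the nested balls is near-critical at every step, with errors
tending to zero. -/
theorem exists_nearCritical (N : Seminorm ℝ (Fin 2 → ℝ)) {a c s : ℝ} (ha : 0 < a) (hc : 0 < c)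
    (hE : ∀ u : Fin 2 → ℝ, a * u 0 ^ 2 + c * u 1 ^ 2 ≤ N u ^ 2) (hs : 0 < s)
    (hsE : 3 * s ^ 2 ≤ 4 * (a * c)) :
    ∃ (ξ : Fin 2 → ℝ) (v : ℕ → Fin 3 → ℤ), StrictMono (fun k => v k 2) ∧ (∀ k, 0 < v k 2) ∧
      ∀ k : ℕ, IsNearCritical N s (1 / (k + 2)) (v k) (v (k + 1)) ξ := by
  have step (k : ℕ) (S : ApproxState) : ∃ S' : ApproxState, S.v 2 < S'.v 2 ∧
      Metric.closedBall (ratPoint S'.v) S'.ρ ⊆ Metric.closedBall (ratPoint S.v) S.ρ ∧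
      ∀ ξ ∈ Metric.closedBall (ratPoint S'.v) S'.ρ,
        IsNearCritical N s (1 / (k + 2)) S.v S'.v ξ := by
    obtain ⟨v', ρ', hρ', hdet, hlt, hsub, hnear⟩ := exists_next_ball N ha hc hE hs hsE S.pos S.det
      (by positivity : (0 : ℝ) < 1 / (k + 2))
      (by rw [div_lt_one (by positivity)]; linarith [(Nat.cast_nonneg k : (0 : ℝ) ≤ k)]) S.ρ_pos
    exact ⟨⟨v', S.y, S.v, ρ', S.pos.trans hlt, hdet, hρ'⟩, hlt, hsub, hnear⟩
  choose next hlt hsub hnear using step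
  let S : ℕ → ApproxState := fun k => Nat.rec
    ⟨![0, 0, 1], ![1, 0, 0], ![0, 1, 0], 1, by simp, by simp [Matrix.det_fin_three], one_pos⟩ next k
  have hS (k : ℕ) : S (k + 1) = next k (S k) := rfl
  obtain ⟨ξ, hξ⟩ := IsCompact.nonempty_iInter_of_sequence_nonempty_isCompact_isClosed
    (fun k => Metric.closedBall (ratPoint (S k).v) (S k).ρ) (fun k => hsub k (S k))
    (fun k => Metric.nonempty_closedBall.2 (S k).ρ_pos.le) (isCompact_closedBall _ _)
    (fun k => Metric.isClosed_closedBall)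
  rw [Set.mem_iInter] at hξ
  exact ⟨ξ, fun k => (S k).v, strictMono_nat_of_lt_succ fun k => hlt k (S k),
    fun k => (S k).pos, fun k => hnear k (S k) ξ (hξ (k + 1))⟩

/-! ### Thresholds -/

/-- The local maxima of the first minimum along the flow are the cube roots of the products
(defect)² × (next denominator), here below `r ^ 3` and tending to `r ^ 3`. -/
theorem isThreshold_of_nearCritical (N : Seminorm ℝ (Fin 2 → ℝ)) {r : ℝ} (hr : 0 < r)
    {ξ : Fin 2 → ℝ} {v : ℕ → Fin 3 → ℤ} (hmono : StrictMono fun k => v k 2)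
    (hpos : ∀ k, 0 < v k 2)
    (hv : ∀ k : ℕ, IsNearCritical N (r ^ 3) (1 / (k + 2)) (v k) (v (k + 1)) ξ) :
    IsThreshold N (approxLattice ξ 0) r := by
  have hposR (k : ℕ) : (0 : ℝ) < v k 2 := by exact_mod_cast hpos k
  have hge (k : ℕ) : (k : ℤ) ≤ v k 2 := by
    induction k with
    | zero => exact (hpos 0).le
    | succ k ih => push_cast; exact Int.add_one_le_of_lt (ih.trans_lt (hmono k.lt_succ_self))
  have htop : Tendsto (fun k => (v k 2 : ℝ)) atTop atTop :=
    tendsto_atTop_mono (fun k => by exact_mod_cast hge k) tendsto_natCast_atTop_atTop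
  have hexp (t : ℝ) : Real.exp (-2 * t) * Real.exp t ^ 2 = 1 := by
    rw [← Real.exp_nat_mul, ← Real.exp_add]; simp
  refine ⟨fun _ => ⟨⟨hr, ?_⟩, ?_⟩, fun h => absurd h hr.ne'⟩
  · -- while `v k 2 < r * exp t ^ 2 ≤ v (k + 1) 2`, the vector `v k` is shorter than `r`
    have hlarge : Tendsto (fun t : ℝ => r * Real.exp t ^ 2) atTop atTop :=
      ((tendsto_pow_atTop two_ne_zero).comp Real.tendsto_exp_atTop).const_mul_atTop hr
    filter_upwards [hlarge.eventually (eventually_gt_atTop (v 0 2 : ℝ))] with t ht hmem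
    rw [flow_approxLattice, zero_add] at hmem
    have hex : ∃ k, r * Real.exp t ^ 2 ≤ v k 2 := (htop.eventually_ge_atTop _).exists
    classical
    obtain ⟨k, hk⟩ : ∃ k, Nat.find hex = k + 1 := by
      refine Nat.exists_eq_succ_of_ne_zero fun h => ?_
      have := Nat.find_spec hex
      rw [h] at this; linarith
    have h1 : r * Real.exp t ^ 2 ≤ v (k + 1) 2 := hk ▸ Nat.find_spec hex
    have h2 : v k 2 < r * Real.exp t ^ 2 := not_le.1 (Nat.find_min hex (by omega : k < _))
    have hvk : v k ≠ 0 := fun h => (hpos k).ne' (by rw [h]; rfl)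
    refine absurd (hmem.2.trans (firstMinimum_le N ξ t hvk)) (not_le.2 (max_lt ?_ ?_))
    · refine lt_of_pow_lt_pow_left₀ 2 hr.le ?_
      refine lt_of_mul_lt_mul_left ?_ hr.le
      calc r * (Real.exp t * N (defect ξ (v k))) ^ 2
          = N (defect ξ (v k)) ^ 2 * (r * Real.exp t ^ 2) := by ring
        _ ≤ N (defect ξ (v k)) ^ 2 * v (k + 1) 2 := by gcongr
        _ < r ^ 3 := (hv k).1
        _ = r * r ^ 2 := by ring
    · rw [abs_of_pos (hposR k)]
      calc Real.exp (-2 * t) * v k 2 < Real.exp (-2 * t) * (r * Real.exp t ^ 2) := by gcongr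
        _ = r * (Real.exp (-2 * t) * Real.exp t ^ 2) := by ring
        _ = r := by rw [hexp, mul_one]
  · rintro ε ⟨hε, hev⟩
    by_contra! hlt
    -- at the time `t` with `r * exp t ^ 2 = v (k + 1) 2` the first minimum is close to `r`
    have htime : Tendsto (fun k => Real.log (v (k + 1) 2 / r) / 2) atTop atTop :=
      (Real.tendsto_log_atTop.comp
        ((htop.comp (tendsto_add_atTop_nat 1)).atTop_div_const hr)).atTop_div_const two_pos
    have hone : Tendsto (fun k : ℕ => r * (1 - 1 / ((k : ℝ) + 2)) ^ 2) atTop (nhds r) := by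
      have h1 : Tendsto (fun k : ℕ => 1 / ((k : ℝ) + 2)) atTop (nhds 0) :=
        tendsto_const_nhds.div_atTop
          (tendsto_atTop_add_const_right _ _ tendsto_natCast_atTop_atTop)
      simpa using ((h1.const_sub 1).pow 2).const_mul r
    obtain ⟨k, hk1, hk2⟩ := ((htime.eventually hev).and (hone.eventually_const_lt hlt)).exists
    set t := Real.log (v (k + 1) 2 / r) / 2 with ht
    have hexp2 : r * Real.exp t ^ 2 = v (k + 1) 2 := by
      rw [← Real.exp_nat_mul, ht, Nat.cast_ofNat, mul_div_cancel₀ _ two_ne_zero,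
        Real.exp_log (div_pos (hposR _) hr), mul_div_cancel₀ _ hr.ne']
    rw [flow_approxLattice, zero_add] at hk1
    refine hk1 ⟨approxLattice_mem ξ t, le_firstMinimum N fun u hu => ?_⟩
    obtain ⟨-, δ, hδ, hδs, hmin⟩ := hv k
    rcases lt_or_ge |u 2| (v (k + 1) 2) with hu2 | hu2
    · refine le_trans ?_ (le_max_left _ _)
      refine hk2.le.trans ?_
      have h3 : 0 ≤ 1 - 1 / ((k : ℝ) + 2) := by
        rw [sub_nonneg, div_le_one (by positivity)]; linarith [(Nat.cast_nonneg k : (0 : ℝ) ≤ k)]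
      have h3' : 1 - 1 / ((k : ℝ) + 2) ≤ 1 := by
        have : 0 ≤ 1 / ((k : ℝ) + 2) := by positivity
        linarith
      have h4 := hmin u hu hu2
      generalize 1 - 1 / ((k : ℝ) + 2) = w at *
      have h5 : r * w ≤ Real.exp t * δ := by
        refine le_of_sq_le_sq ?_ (by positivity)
        refine le_of_mul_le_mul_left ?_ hr
        calc r * (r * w) ^ 2 = r ^ 3 * w * w := by ring
          _ ≤ r ^ 3 * w * 1 := by gcongr
          _ ≤ δ ^ 2 * v (k + 1) 2 := by rw [mul_one]; exact hδs
          _ = r * (Real.exp t * δ) ^ 2 := by rw [← hexp2]; ring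
      calc r * w ^ 2 = r * w * w := by ring
        _ ≤ Real.exp t * δ * w := by gcongr
        _ = Real.exp t * (w * δ) := by ring
        _ ≤ _ := by gcongr
    · refine le_trans ?_ (le_max_right _ _)
      have h3 : (v (k + 1) 2 : ℝ) ≤ |(u 2 : ℝ)| := by exact_mod_cast hu2
      calc ε ≤ r * (Real.exp (-2 * t) * Real.exp t ^ 2) := by rw [hexp, mul_one]; exact hlt.le
        _ = Real.exp (-2 * t) * v (k + 1) 2 := by rw [← hexp2]; ring
        _ ≤ _ := by gcongr

/-- The trajectory of `ℤ³` diverges, as the flow contracts the vector `(0, 0, 1)`. -/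
theorem isThreshold_zero (N : Seminorm ℝ (Fin 2 → ℝ)) :
    IsThreshold N (approxLattice 0 0) 0 := by
  have h (ε : ℝ) (hε : 0 < ε) : ε ∈ escapeSet N (approxLattice 0 0) := by
    refine ⟨hε, ?_⟩
    have h0 : Tendsto (fun t : ℝ => Real.exp (-2 * t)) atTop (nhds 0) :=
      Real.tendsto_exp_atBot.comp (tendsto_id.const_mul_atTop_of_neg (by norm_num))
    filter_upwards [h0.eventually_lt_const hε] with t ht hmem
    rw [flow_approxLattice, zero_add] at hmem
    have h1 := hmem.2.trans (firstMinimum_le N 0 t (u := ![0, 0, 1])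
      (fun h => by simpa using congrFun h 2))
    have h2 : defect 0 ![0, 0, 1] = 0 := by ext l; fin_cases l <;> simp [defect]
    have h3 : ε ≤ Real.exp (-2 * t) := by simpa [h2, Real.exp_nonneg, hε] using h1
    linarith
  refine ⟨fun h => absurd h (lt_irrefl _), fun _ => ⟨fun ε hε => hε.1.le, fun b hb => ?_⟩⟩
  refine le_of_forall_pos_le_add fun ε hε => ?_
  simpa using hb (h ε hε)

/-! ### Ellipsoid parameters -/

/-- A norm on the plane dominates a multiple of the supremum norm. -/
theorem exists_pos_mul_norm_le (N : Seminorm ℝ (Fin 2 → ℝ)) (hN : ∀ x, N x = 0 → x = 0) :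
    ∃ m, 0 < m ∧ ∀ u, m * ‖u‖ ≤ N u := by
  obtain ⟨w, hw, hmin⟩ := (isCompact_sphere (0 : Fin 2 → ℝ) 1).exists_isMinOn
    (NormedSpace.sphere_nonempty.2 zero_le_one) (continuous_seminorm N).continuousOn
  have hw1 : ‖w‖ = 1 := by simpa using hw
  refine ⟨N w, lt_of_le_of_ne (apply_nonneg N w) fun h => ?_, fun u => ?_⟩
  · rw [hN w h.symm] at hw1; simp at hw1
  · rcases eq_or_ne u 0 with rfl | hu
    · simp
    · have hu0 : 0 < ‖u‖ := norm_pos_iff.2 hu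
      have h1 : N w ≤ N (‖u‖⁻¹ • u) := hmin (by simp [norm_smul, hu0.ne'])
      rw [map_smul_eq_mul, norm_inv, norm_norm, ← div_eq_inv_mul, le_div_iff₀ hu0] at h1
      exact h1

theorem exists_isEllipsoidParams (N : Seminorm ℝ (Fin 2 → ℝ)) (hN : ∀ x, N x = 0 → x = 0) :
    ∃ a c D, IsEllipsoidParams N a c D := by
  obtain ⟨m, hm, hmN⟩ := exists_pos_mul_norm_le N hN
  obtain ⟨C, hC, hCN⟩ := exists_pos_le_mul_norm N
  have hmC : m ≤ C := by
    have h := (hmN ![1, 0]).trans (hCN ![1, 0])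
    refine le_of_mul_le_mul_right h (norm_pos_iff.2 fun h => ?_)
    simpa using congrFun h 0
  refine ⟨m ^ 2 / 2, m ^ 2 / 2, 2 * (C / m), by positivity, by positivity, ?_, fun u => ?_⟩
  · have : 1 ≤ C / m := (one_le_div hm).2 hmC
    linarith
  · have h0 : u 0 ^ 2 ≤ ‖u‖ ^ 2 := sq_le_sq.2 (by simpa using norm_le_pi_norm u 0)
    have h1 : u 1 ^ 2 ≤ ‖u‖ ^ 2 := sq_le_sq.2 (by simpa using norm_le_pi_norm u 1)
    have hge : ‖u‖ ^ 2 ≤ u 0 ^ 2 + u 1 ^ 2 := by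
      have : ‖u‖ ≤ Real.sqrt (u 0 ^ 2 + u 1 ^ 2) := by
        refine (pi_norm_le_iff_of_nonneg (Real.sqrt_nonneg _)).2 fun l => ?_
        refine Real.abs_le_sqrt ?_
        fin_cases l <;> simp <;> positivity
      exact (Real.le_sqrt (norm_nonneg u) (by positivity)).1 this
    constructor
    · refine le_trans (Real.sqrt_le_iff.2 ⟨by positivity, ?_⟩) (hmN u)
      rw [mul_pow]
      nlinarith [sq_nonneg m]
    · refine (hCN u).trans ?_
      have h2 : m * ‖u‖ / 2 ≤ Real.sqrt (m ^ 2 / 2 * u 0 ^ 2 + m ^ 2 / 2 * u 1 ^ 2) := by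
        refine Real.le_sqrt_of_sq_le ?_
        rw [div_pow, mul_pow]
        nlinarith [mul_le_mul_of_nonneg_left hge (sq_nonneg m),
          mul_nonneg (sq_nonneg m) (sq_nonneg ‖u‖)]
      calc C * ‖u‖ = 2 * (C / m) * (m * ‖u‖ / 2) := by field_simp
        _ ≤ _ := by gcongr

theorem IsEllipsoidParams.le_sq {N : Seminorm ℝ (Fin 2 → ℝ)} {a c D : ℝ}
    (h : IsEllipsoidParams N a c D) (u : Fin 2 → ℝ) : a * u 0 ^ 2 + c * u 1 ^ 2 ≤ N u ^ 2 :=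
  (Real.sqrt_le_left (apply_nonneg N u)).1 (h.2.2.2 u).1

theorem exists_isGreatest_ellipsoidValues (N : Seminorm ℝ (Fin 2 → ℝ))
    (hN : ∀ x, N x = 0 → x = 0) : ∃ m, IsGreatest (ellipsoidValues N) m := by
  obtain ⟨a₀, c₀, D₀, h₀⟩ := exists_isEllipsoidParams N hN
  have hpos {D : ℝ} (hD : 1 ≤ D) : 0 < 4 * D ^ 2 - 1 := by nlinarith
  obtain ⟨w, hw⟩ : ∃ w, w = 4 * a₀ * c₀ / (4 * D₀ ^ 2 - 1) := ⟨_, rfl⟩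
  have hw0 : 0 < w := by
    rw [hw]; have := h₀.1; have := h₀.2.1; have := hpos h₀.2.2.1; positivity
  obtain ⟨A, hA⟩ : ∃ A, A = N ![1, 0] ^ 2 := ⟨_, rfl⟩
  obtain ⟨C, hC⟩ : ∃ C, C = N ![0, 1] ^ 2 := ⟨_, rfl⟩
  -- the parameters with value at least the value of `(a₀, c₀, D₀)`, as closed conditions
  let K : Set (ℝ × ℝ × ℝ) := Set.Icc 0 A ×ˢ Set.Icc 0 C ×ˢ Set.Icc 1 (4 * A * C / w + 1) ∩
    {p | w * (4 * p.2.2 ^ 2 - 1) ≤ 4 * p.1 * p.2.1 ∧ ∀ u : Fin 2 → ℝ,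
      Real.sqrt (p.1 * u 0 ^ 2 + p.2.1 * u 1 ^ 2) ≤ N u ∧
        N u ≤ p.2.2 * Real.sqrt (p.1 * u 0 ^ 2 + p.2.1 * u 1 ^ 2)}
  have hKc : IsCompact K := by
    refine (isCompact_Icc.prod (isCompact_Icc.prod isCompact_Icc)).inter_right ?_
    simp only [Set.ofPred_and, Set.ofPred_forall]
    exact (isClosed_le (by fun_prop) (by fun_prop)).inter <| isClosed_iInter fun u =>
      (isClosed_le (by fun_prop) (by fun_prop)).inter (isClosed_le (by fun_prop) (by fun_prop))
  have hmem {a c D : ℝ} (h : IsEllipsoidParams N a c D)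
      (hv : w ≤ 4 * a * c / (4 * D ^ 2 - 1)) : (a, c, D) ∈ K := by
    have hle := h.le_sq
    obtain ⟨ha, hc, hD, hu⟩ := h
    rw [le_div_iff₀ (hpos hD)] at hv
    have haA : a ≤ A := by simpa [hA] using hle ![1, 0]
    have hcC : c ≤ C := by simpa [hC] using hle ![0, 1]
    refine ⟨⟨⟨ha.le, haA⟩, ⟨hc.le, hcC⟩, hD, ?_⟩, hv, hu⟩
    have h1 : w * (4 * D ^ 2 - 1) ≤ 4 * A * C := hv.trans (mul_le_mul (by linarith) hcC hc.le (by linarith))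
    rw [← le_div_iff₀' hw0] at h1
    show D ≤ 4 * A * C / w + 1
    nlinarith
  have hKpos {p : ℝ × ℝ × ℝ} (hp : p ∈ K) : IsEllipsoidParams N p.1 p.2.1 p.2.2 := by
    obtain ⟨⟨⟨ha, -⟩, ⟨hc, -⟩, hD, -⟩, hv, hu⟩ := hp
    have h1 : 0 < 4 * p.1 * p.2.1 := lt_of_lt_of_le (mul_pos hw0 (hpos hD)) hv
    refine ⟨lt_of_le_of_ne ha fun h => ?_, lt_of_le_of_ne hc fun h => ?_, hD, hu⟩
    · rw [← h] at h1; simp at h1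
    · rw [← h] at h1; simp at h1
  have hcont : ContinuousOn
      (fun p : ℝ × ℝ × ℝ => 4 * p.1 * p.2.1 / (4 * p.2.2 ^ 2 - 1)) K :=
    ContinuousOn.div (by fun_prop) (by fun_prop) fun p hp => (hpos (hKpos hp).2.2.1).ne'
  obtain ⟨p, hp, hmax⟩ := hKc.exists_isMaxOn ⟨_, hmem h₀ hw.le⟩ hcont
  refine ⟨_, ⟨p.1, p.2.1, p.2.2, hKpos hp, rfl⟩, ?_⟩
  rintro _ ⟨a, c, D, h, rfl⟩
  have h1 : 0 < 4 * a * c / (4 * D ^ 2 - 1) := by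
    have := h.1; have := h.2.1; have := hpos h.2.2.1; positivity
  refine Real.rpow_le_rpow h1.le ?_ (by norm_num)
  rcases le_total w (4 * a * c / (4 * D ^ 2 - 1)) with hle | hle
  · exact hmax (hmem h hle)
  · refine hle.trans ?_
    rw [hw]; exact hmax (hmem h₀ hw.le)

/-- Since `4 * D ^ 2 - 1 ≥ 3`, a value `r ≤ M ^ (2 / 3)` satisfies the hexagonal bound
`3 * (r ^ 3) ^ 2 ≤ 4 * a * c` for the inner ellipsoid norm. -/
theorem three_mul_cube_sq_le {a c D r : ℝ} (ha : 0 < a) (hc : 0 < c) (hD : 1 ≤ D) (hr : 0 ≤ r)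
    (h : r ≤ ((4 * a * c / (4 * D ^ 2 - 1)) ^ (1 / 4 : ℝ)) ^ (2 / 3 : ℝ)) :
    3 * (r ^ 3) ^ 2 ≤ 4 * (a * c) := by
  have hD3 : 3 ≤ 4 * D ^ 2 - 1 := by nlinarith
  have hD0 : 0 < 4 * D ^ 2 - 1 := by linarith
  have hX : 0 ≤ 4 * a * c / (4 * D ^ 2 - 1) := by positivity
  have h1 : r ^ 6 ≤ 4 * a * c / (4 * D ^ 2 - 1) := by
    calc r ^ 6 ≤ (((4 * a * c / (4 * D ^ 2 - 1)) ^ (1 / 4 : ℝ)) ^ (2 / 3 : ℝ)) ^ 6 := by gcongr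
      _ = 4 * a * c / (4 * D ^ 2 - 1) := by
        rw [← Real.rpow_mul hX, ← Real.rpow_natCast, ← Real.rpow_mul hX]; norm_num
  rw [le_div_iff₀ hD0] at h1
  have h2 : r ^ 6 * 3 ≤ r ^ 6 * (4 * D ^ 2 - 1) := by gcongr
  linarith

end DirichletLattice

theorem corollary3 (N : Seminorm ℝ (Fin 2 → ℝ)) (hN : ∀ x : Fin 2 → ℝ, N x = 0 → x = 0) :
    IsGreatest (DirichletLattice.ellipsoidValues N) (DirichletLattice.ellipsoidConstant N) ∧
      ∀ r : ℝ, 0 ≤ r → r ≤ DirichletLattice.ellipsoidConstant N ^ (2 / 3 : ℝ) →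
        #{L : Submodule ℤ (Fin 3 → ℝ) |
          L ∈ DirichletLattice.unimodularLattices ∧ DirichletLattice.IsThreshold N L r} = 𝔠 := by
  open DirichletLattice in
  obtain ⟨m, hm⟩ := exists_isGreatest_ellipsoidValues N hN
  have hM : IsGreatest (ellipsoidValues N) (ellipsoidConstant N) := by
    rwa [ellipsoidConstant, hm.csSup_eq]
  refine ⟨hM, fun r hr hrM => ?_⟩
  rcases hr.eq_or_lt with rfl | hr0
  · exact mk_threshold_eq N (isThreshold_zero N)
  · obtain ⟨a, c, D, h, hMe⟩ := hM.1
    rw [hMe] at hrM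
    obtain ⟨ξ, v, hmono, hpos, hv⟩ := exists_nearCritical N h.1 h.2.1 h.le_sq (pow_pos hr0 3)
      (three_mul_cube_sq_le h.1 h.2.1 h.2.2.1 hr hrM)
    exact mk_threshold_eq N (isThreshold_of_nearCritical N hr0 hmono hpos hv)
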